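/- Setting. Let $X$ be a finite non-empty set and $Y$ a finite abelian group; the oracle is a function $H: X\to Y$, accessed quantumly through $U_H:|x,y\rangle\mapsto|x,y+H(x)\rangle$. A $q$-query quantum algorithm is a sequence of $q+1$ local unitaries interleaved with $q$ applications of $U_H$, on a register of arbitrary finite dimension, followed by a measurement in the computational basis. A game $G$ consists of two deterministic classical oracle algorithms: $\mathsf{Samp}^H(r)$, which on coins $r$ from a finite non-empty set $\mathcal R$ outputs a challenge and makes at most $T_{\mathsf{Samp}}$ queries, and $\mathsf{Verify}^H(r,\mathsf{ans})$, which decides whether the answer wins and makes at most $T_{\mathsf{Verify}}$ queries. The game is played by drawing $r\in\mathcal R$ uniformly, giving $\mathsf{ch}=\mathsf{Samp}^H(r)$ to the algorithm, and applying $\mathsf{Verify}^H(r,\cdot)$ to its answer. An $(S,T)$ non-uniform quantum algorithm with quantum advice consists of an $S$-qubit pure state $|\sigma_H\rangle$ for every $H$ and, for every challenge, a quantum algorithm making at most $T$ queries, which is run on $|\sigma_H\rangle$ together with ancillas in a fixed basis state. $G$ has security $\delta$ against such algorithms if each of them wins with probability at most $\delta$, for $H$ uniformly random. For a real $P\ge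 0$, a $(P,T)$ algorithm in the $P$-bit-fixing QROM ($P$-BF-QROM) consists of a quantum algorithm $f$ without input, making at most $P$ queries and outputting a bit $b$ and a leftover quantum state $\tau$, and an online algorithm $\mathcal B$ which receives $\tau$ and the challenge and makes at most $T$ queries. $G$ has security $\nu$ in the $P$-BF-QROM (against $T$ queries) if for all such $(f,\mathcal B)$ with $\Pr_H[f^H=0]>0$, the probability that $\mathcal B$ wins $G$, conditioned on $f^H$ outputting $b=0$ (with $H$ uniformly random before conditioning), is at most $\nu$. Theorem. Let $G$ be any game, let $S,T$ be non-negative integers, and let $P=S(T+T_{\mathsf{Verify}}+T_{\mathsf{Samp}})$. (1) If $G$ has security $\nu(P,T)$ in the $P$-BF-QROM, then it has security $2\,\nu(P,T)$ against $(S,T)$ non-uniform quantum algorithms with quantum advice. (2) If for every real $\gamma>0$ the game $G$ has security $\nu(P/\gamma,T)$ in the $(P/\gamma)$-BF-QROM, then it has security $$\inf_{\gamma>0}\bigl\{\nu(P/\gamma,T)+\gamma\bigr\}$$ against $(S,T)$ non-uniform quantum algorithms with quantum advice. -/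

import Mathlib

namespace QROM

/-- Deterministic classical algorithms with oracle access to a function `X → Y`: either return a
value, or query a point and continue depending on the answer. -/
inductive OracleAlg (X Y α : Type) : Type
  | ret (a : α) : OracleAlg X Y α
  | query (x : X) (next : Y → OracleAlg X Y α) : OracleAlg X Y α

namespace OracleAlg

/-- The output of the algorithm when it is run with the oracle `H`. -/
def eval {X Y α : Type} (H : X → Y) : OracleAlg X Y α → α
  | ret a => a
  | query x next => (next (H x)).eval H

/-- The number of queries made when the algorithm is run with the oracle `H`. -/
def numQueries {X Y α : Type} (H : X → Y) : OracleAlg X Y α → ℕ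
  | ret _ => 0
  | query x next => (next (H x)).numQueries H + 1

end OracleAlg

/-- A game relative to an oracle `H : X → Y`, with random coins in `R`, challenges in `Ch` and
answers in `Ans`. The outcome `true` of `verify` means that the game is won. -/
structure Game (X Y R Ch Ans : Type) where
  samp : R → OracleAlg X Y Ch
  verify : R → Ans → OracleAlg X Y Bool
  /-- the number of queries made by `samp` -/
  tSamp : ℕ
  /-- the number of queries made by `verify` -/
  tVerify : ℕ
  samp_queries : ∀ r H, (samp r).numQueries H ≤ tSamp
  verify_queries : ∀ r ans H, (verify r ans).numQueries H ≤ tVerify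

/-- The permutation `(x, y, w) ↦ (x, y + H x, w)` of the computational basis states. -/
def queryPerm {X Y W : Type} [AddCommGroup Y] (H : X → Y) : Equiv.Perm (X × Y × W) where
  toFun b := (b.1, b.2.1 + H b.1, b.2.2)
  invFun b := (b.1, b.2.1 - H b.1, b.2.2)
  left_inv b := by simp
  right_inv b := by simp

/-- Unitary operators on `ℂ^B`, where `B` labels the computational basis. -/
abbrev UnitaryOp (B : Type) [Fintype B] : Type :=
  EuclideanSpace ℂ B ≃ₗᵢ[ℂ] EuclideanSpace ℂ B

/-- The oracle unitary `|x, y, w⟩ ↦ |x, y + H x, w⟩`. -/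
noncomputable def oracle {X Y W : Type} [Fintype X] [AddCommGroup Y] [Fintype Y] [Fintype W]
    (H : X → Y) : UnitaryOp (X × Y × W) :=
  LinearIsometryEquiv.piLpCongrLeft 2 ℂ ℂ (queryPerm H)

/-- A quantum oracle algorithm on the query registers `X`, `Y` and a work register `W`: a sequence
`U₁, O_H, U₂, O_H, …, O_H, U_{q+1}` of local unitaries interleaved with oracle calls. -/
inductive QueryCircuit (X Y W : Type) [Fintype X] [Fintype Y] [Fintype W] : Type
  | start (U : UnitaryOp (X × Y × W)) : QueryCircuit X Y W
  | step (C : QueryCircuit X Y W) (U : UnitaryOp (X × Y × W)) : QueryCircuit X Y W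

namespace QueryCircuit

variable {X Y W : Type} [Fintype X] [AddCommGroup Y] [Fintype Y] [Fintype W]

/-- The unitary implemented by the circuit when its oracle is `H`. -/
noncomputable def run (H : X → Y) : QueryCircuit X Y W → UnitaryOp (X × Y × W)
  | start U => U
  | step C U => ((C.run H).trans (oracle H)).trans U

/-- The number of oracle calls. -/
def numQueries {X Y W : Type} [Fintype X] [Fintype Y] [Fintype W] : QueryCircuit X Y W → ℕ
  | start _ => 0
  | step C _ => C.numQueries + 1

end QueryCircuit

/-- A non-uniform quantum algorithm with `S` qubits of quantum advice. The computational basis of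
its register is labelled by the query registers `X`, `Y`, the advice register `Fin S → Bool` and an
ancilla register `W` of arbitrary finite dimension. -/
structure NonUniformAlg (X Y Ch Ans : Type) [Fintype X] [Fintype Y] (S : ℕ) where
  W : Type
  [fintypeW : Fintype W]
  /-- the initial basis state of the query registers and the ancillas -/
  x₀ : X
  y₀ : Y
  w₀ : W
  /-- the advice state for each oracle -/
  advice : (X → Y) → EuclideanSpace ℂ (Fin S → Bool)
  advice_norm : ∀ H, ‖advice H‖ = 1
  /-- the circuit applied on each challenge -/
  circuit : Ch → QueryCircuit X Y ((Fin S → Bool) × W)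
  /-- the answer encoded in each basis state (read off by the final measurement) -/
  out : X × Y × (Fin S → Bool) × W → Ans

attribute [instance] NonUniformAlg.fintypeW

/-- An algorithm in the bit-fixing model. The first stage `f` starts in a basis state, runs a
query circuit and measures a bit in the computational basis; the state `τ` left over on the whole
register is handed to the online stage `B`, which continues on that register (`W` also contains the
ancillas of `B`, which `f` may leave untouched). -/
structure BitFixingAlg (X Y Ch Ans : Type) [Fintype X] [Fintype Y] where
  W : Type
  [fintypeW : Fintype W]
  /-- the initial basis state of the register -/
  x₀ : X
  y₀ : Y
  w₀ : W
  /-- the circuit of the first stage -/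
  f : QueryCircuit X Y W
  /-- the output bit of the first stage encoded in each basis state -/
  bit : X × Y × W → Fin 2
  /-- the circuit of the online stage on each challenge -/
  B : Ch → QueryCircuit X Y W
  /-- the answer encoded in each basis state -/
  out : X × Y × W → Ans

attribute [instance] BitFixingAlg.fintypeW

section Probabilities

variable {X Y R Ch Ans : Type} [Fintype X] [AddCommGroup Y] [Fintype Y] [Fintype R]

open Classical in
/-- For a fixed oracle `H`, the probability, over uniform coins `r` and the final measurement, that
the game is won by running on the challenge the circuit `circuit` on the state `ψ` and answering
according to `out`. For unnormalized `ψ` this is the probability weighted by `‖ψ‖²`. -/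
noncomputable def Game.winWeight (G : Game X Y R Ch Ans) {W : Type} [Fintype W] (H : X → Y)
    (circuit : Ch → QueryCircuit X Y W) (out : X × Y × W → Ans)
    (ψ : EuclideanSpace ℂ (X × Y × W)) : ℝ :=
  (∑ r : R, ∑ b : X × Y × W,
    if (G.verify r (out b)).eval H = true
      then ‖((circuit ((G.samp r).eval H)).run H ψ) b‖ ^ 2 else 0) / Fintype.card R

namespace NonUniformAlg

open Classical in
/-- The initial state `|x₀, y₀⟩ ⊗ |σ_H⟩ ⊗ |w₀⟩`. -/
noncomputable def initState {S : ℕ} (A : NonUniformAlg X Y Ch Ans S) (H : X → Y) :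
    EuclideanSpace ℂ (X × Y × (Fin S → Bool) × A.W) :=
  WithLp.toLp 2 fun b =>
    if b.1 = A.x₀ ∧ b.2.1 = A.y₀ ∧ b.2.2.2 = A.w₀ then A.advice H b.2.2.1 else 0

open Classical in
/-- The probability of winning the game, for a uniformly random oracle. -/
noncomputable def winProb {S : ℕ} (A : NonUniformAlg X Y Ch Ans S) (G : Game X Y R Ch Ans) : ℝ :=
  (∑ H : X → Y, G.winWeight H A.circuit A.out (A.initState H)) / Fintype.card (X → Y)

end NonUniformAlg

namespace BitFixingAlg

open Classical in
/-- The unnormalized state after the first stage with oracle `H` has output the bit `0`. -/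
noncomputable def leftover (A : BitFixingAlg X Y Ch Ans) (H : X → Y) :
    EuclideanSpace ℂ (X × Y × A.W) :=
  WithLp.toLp 2 fun b =>
    if A.bit b = 0 then (A.f.run H (EuclideanSpace.single (A.x₀, A.y₀, A.w₀) 1)) b else 0

open Classical in
/-- `Pr_H[f^H = 0]` for a uniformly random oracle. -/
noncomputable def acceptProb (A : BitFixingAlg X Y Ch Ans) : ℝ :=
  (∑ H : X → Y, ‖A.leftover H‖ ^ 2) / Fintype.card (X → Y)

open Classical in
/-- `Pr_H[f^H = 0 ∧ the online stage wins]` for a uniformly random oracle. -/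
noncomputable def jointProb (A : BitFixingAlg X Y Ch Ans) (G : Game X Y R Ch Ans) : ℝ :=
  (∑ H : X → Y, G.winWeight H A.B A.out (A.leftover H)) / Fintype.card (X → Y)

/-- The winning probability in the bit-fixing model, i.e. conditioned on `f^H = 0` (meaningful only
if `f^H = 0` has positive probability). -/
noncomputable def winProb (A : BitFixingAlg X Y Ch Ans) (G : Game X Y R Ch Ans) : ℝ :=
  A.jointProb G / A.acceptProb

end BitFixingAlg

/-- `G` has security `δ` against `(S, T)` non-uniform quantum algorithms with quantum advice. -/
def Game.NonUniformSecure (G : Game X Y R Ch Ans) (S T : ℕ) (δ : ℝ) : Prop :=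
  ∀ A : NonUniformAlg X Y Ch Ans S, (∀ ch, (A.circuit ch).numQueries ≤ T) → A.winProb G ≤ δ

/-- `G` has security `ν` in the `P`-bit-fixing QROM against `T`-query online algorithms. The query
bound `P` is a real number, so that non-integral values of it make sense. -/
def Game.BitFixingSecure (G : Game X Y R Ch Ans) (P : ℝ) (T : ℕ) (ν : ℝ) : Prop :=
  ∀ A : BitFixingAlg X Y Ch Ans, (A.f.numQueries : ℝ) ≤ P → (∀ ch, (A.B ch).numQueries ≤ T) →
    0 < A.acceptProb → A.winProb G ≤ ν

end Probabilities

end QROM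

set_option linter.unusedSectionVars false

/-! Let `t = tSamp + T + tVerify`. Playing the game coherently and projecting on the winning
outcomes gives, for each `H`, an operator `V H` on the advice space with `‖V H σ‖²` equal to the
winning probability on advice `σ` (`Game.exists_winOperator`). Put `M H = (V H)† (V H)` and, for a
family of states `φ`, let `m_j(φ)` be the average over `H` of `⟨φ H, (M H)^j (φ H)⟩`. By
Cauchy-Schwarz `m_j(φ)` is log-convex in `j` (`moment_logConvex`), and `m_0 = 1` for unit vectors.

For the advice family, `m_1` is the winning probability, and log-convexity gives `m_1 ^ n ≤ m_n`.
For `n = 2i+1` the moment is an average of `‖V M^i σ_H‖²`, and each of these is at most the sum of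
`‖V M^i |q⟩‖²` over the `2^S` basis states `q` (`norm_sq_le_sum_ket`). This removes the dependence
of the advice on `H` at the price of a factor `2^S`.

For a fixed `q`, the subnormalized state `M^i |q⟩` is prepared with `2it` queries by applying `V`
and `V†` alternately and postselecting. Taking this as the first stage of a bit-fixing algorithm,
security says exactly that `m_{2i+1} ≤ ν m_{2i}` (`Game.BitFixingSecure.sum_winWeight_le`). Ratios
of consecutive moments are nondecreasing, so this bound on the last ratio gives `m_{2i+1} ≤ ν ^
(2i+1)`.

Altogether `winProb ^ (2i+1) ≤ 2^S ν ^ (2i+1)` whenever `2it` is within the query bound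
(`NonUniformAlg.winProb_pow_le`). Part (1) takes `i = ⌊S/2⌋`, part (2) takes `i = ⌊S/(2γ)⌋`. -/

namespace QROM

/-! ### Relabelling isometries, adjoints and extension to unitaries -/

section Push

variable {D D' D'' : Type} [Fintype D] [Fintype D'] [Fintype D'']

/-- The isometry `|d⟩ ↦ |j d⟩` induced by an injection of basis labels. -/
noncomputable def push (j : D ↪ D') : EuclideanSpace ℂ D →ₗᵢ[ℂ] EuclideanSpace ℂ D' where
  toFun ψ := WithLp.toLp 2 (Function.extend j ψ 0)
  map_add' ψ φ := by
    ext d'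
    by_cases h : ∃ d, j d = d'
    · obtain ⟨d, rfl⟩ := h
      simp [j.injective.extend_apply]
    · simp [Function.extend_apply' _ _ _ h]
  map_smul' c ψ := by
    ext d'
    by_cases h : ∃ d, j d = d'
    · obtain ⟨d, rfl⟩ := h
      simp [j.injective.extend_apply]
    · simp [Function.extend_apply' _ _ _ h]
  norm_map' ψ := by
    rw [EuclideanSpace.norm_eq, EuclideanSpace.norm_eq]
    congr 1
    symm
    refine Fintype.sum_of_injective j j.injective _ _ (fun d' h => ?_) (fun d => ?_)
    · have h' : ¬ ∃ d, j d = d' := h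
      simp [Function.extend_apply' _ _ _ h']
    · simp [j.injective.extend_apply]

@[simp]
theorem push_apply (j : D ↪ D') (ψ : EuclideanSpace ℂ D) (d : D) : push j ψ (j d) = ψ d :=
  j.injective.extend_apply _ _ _

theorem push_apply_of_eq (j : D ↪ D') (ψ : EuclideanSpace ℂ D) {d : D} {d' : D'} (h : j d = d') :
    push j ψ d' = ψ d := by
  rw [← h, push_apply]

theorem push_apply_of_forall_ne (j : D ↪ D') (ψ : EuclideanSpace ℂ D) {d' : D'}
    (h : ∀ d, j d ≠ d') : push j ψ d' = 0 :=
  Function.extend_apply' _ _ _ (by rintro ⟨d, hd⟩; exact h d hd)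

theorem push_push (j : D ↪ D') (j' : D' ↪ D'') (ψ : EuclideanSpace ℂ D) :
    push j' (push j ψ) = push (j.trans j') ψ := by
  ext d''
  by_cases h : ∃ d', j' d' = d''
  · obtain ⟨d', rfl⟩ := h
    rw [push_apply]
    by_cases h : ∃ d, j d = d'
    · obtain ⟨d, rfl⟩ := h
      rw [push_apply]
      exact (push_apply (j.trans j') ψ d).symm
    · push Not at h
      rw [push_apply_of_forall_ne _ _ h, push_apply_of_forall_ne]
      intro d hd
      exact h d (j'.injective hd)
  · push Not at h
    rw [push_apply_of_forall_ne _ _ h, push_apply_of_forall_ne]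
    intro d hd
    exact h _ hd

open Classical in
/-- The basis state `|d⟩`. -/
noncomputable def ket (d : D) : EuclideanSpace ℂ D := EuclideanSpace.single d 1

theorem ket_eq_single [DecidableEq D] (d : D) : ket d = EuclideanSpace.single d (1 : ℂ) := by
  unfold ket
  congr
  exact Subsingleton.elim _ _

theorem inner_ket (d : D) (ψ : EuclideanSpace ℂ D) : inner ℂ (ket d) ψ = ψ d := by
  classical
  rw [ket_eq_single, EuclideanSpace.inner_single_left, map_one, one_mul]

@[simp]
theorem norm_ket (d : D) : ‖ket d‖ = 1 := by
  classical
  simp [ket_eq_single]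

theorem push_ket (j : D ↪ D') (d : D) : push j (ket d) = ket (j d) := by
  classical
  rw [ket_eq_single, ket_eq_single]
  ext d'
  by_cases h : ∃ e, j e = d'
  · obtain ⟨e, rfl⟩ := h
    rw [push_apply]
    simp
  · push Not at h
    rw [push_apply_of_forall_ne _ _ h]
    simp [(h d).symm]

theorem sum_norm_sq_push (j : D ↪ D') (ψ : EuclideanSpace ℂ D) (p : D' → Prop)
    [DecidablePred p] :
    ∑ d', (if p d' then ‖push j ψ d'‖ ^ 2 else 0) = ∑ d, if p (j d) then ‖ψ d‖ ^ 2 else 0 := by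
  symm
  refine Fintype.sum_of_injective j j.injective _ _ (fun d' h => ?_) (fun d => ?_)
  · rw [push_apply_of_forall_ne]
    · simp
    · intro d hd
      exact h ⟨d, hd⟩
  · simp

/-- The adjoint of an isometry. -/
noncomputable abbrev adj (L : EuclideanSpace ℂ D →ₗᵢ[ℂ] EuclideanSpace ℂ D') :
    EuclideanSpace ℂ D' →L[ℂ] EuclideanSpace ℂ D :=
  ContinuousLinearMap.adjoint L.toContinuousLinearMap

theorem adj_inner (L : EuclideanSpace ℂ D →ₗᵢ[ℂ] EuclideanSpace ℂ D') (x : EuclideanSpace ℂ D)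
    (y : EuclideanSpace ℂ D') : inner ℂ x (adj L y) = inner ℂ (L x) y :=
  ContinuousLinearMap.adjoint_inner_right L.toContinuousLinearMap x y

@[simp]
theorem adj_apply_self (L : EuclideanSpace ℂ D →ₗᵢ[ℂ] EuclideanSpace ℂ D')
    (x : EuclideanSpace ℂ D) : adj L (L x) = x := by
  refine ext_inner_left ℂ fun y => ?_
  rw [adj_inner, L.inner_map_map]

theorem adj_push (j : D ↪ D') (ψ : EuclideanSpace ℂ D') (d : D) : adj (push j) ψ d = ψ (j d) := by
  rw [← inner_ket, adj_inner, push_ket, inner_ket]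

theorem inner_push_push_eq_zero (j : D ↪ D'') (j' : D' ↪ D'') (h : ∀ d d', j d ≠ j' d')
    (ψ : EuclideanSpace ℂ D) (φ : EuclideanSpace ℂ D') : inner ℂ (push j ψ) (push j' φ) = 0 := by
  rw [← adj_inner]
  have : adj (push j) (push j' φ) = 0 := by
    ext d
    rw [adj_push, push_apply_of_forall_ne _ _ fun d' => (h d d').symm]
    rfl
  rw [this, inner_zero_right]

/-- Two isometries with the same finite-dimensional domain differ by a unitary. -/
theorem exists_unitaryOp (f g : EuclideanSpace ℂ D →ₗᵢ[ℂ] EuclideanSpace ℂ D') :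
    ∃ U : UnitaryOp D', ∀ v, U (f v) = g v := by
  let e := f.equivRange
  -- `g ∘ f⁻¹` is an isometry from the range of `f` into the same finite-dimensional space, so it
  -- extends to an isometry of the whole space, which is onto by dimension.
  let L : LinearMap.range f.toLinearMap →ₗᵢ[ℂ] EuclideanSpace ℂ D' :=
    g.comp e.symm.toLinearIsometry
  refine ⟨L.extend.toLinearIsometryEquiv rfl, fun v => ?_⟩
  have h := L.extend_apply (e v)
  have h2 : ((e v : LinearMap.range f.toLinearMap) : EuclideanSpace ℂ D') = f v := rfl
  rw [h2] at h
  rw [LinearIsometry.coe_toLinearIsometryEquiv, h]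
  simp [L]

end Push

/-! ### Enlarging the work register of a circuit -/

section Circuits

variable {X Y W W' Z : Type} [Fintype X] [AddCommGroup Y] [Fintype Y] [Fintype W] [Fintype W']
  [Fintype Z]

@[simp]
theorem oracle_apply (H : X → Y) (ψ : EuclideanSpace ℂ (X × Y × W)) (x : X) (y : Y) (w : W) :
    oracle H ψ (x, y, w) = ψ (x, y - H x, w) := rfl

/-- The injection of basis labels induced by an injection of work registers. -/
def workEmb (X Y : Type) (j : W ↪ W') : X × Y × W ↪ X × Y × W' where
  toFun b := (b.1, b.2.1, j b.2.2)
  inj' := by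
    rintro ⟨x, y, w⟩ ⟨x', y', w'⟩ h
    simpa using h

@[simp]
theorem workEmb_apply (j : W ↪ W') (x : X) (y : Y) (w : W) :
    workEmb X Y j (x, y, w) = (x, y, j w) := rfl

theorem oracle_push (j : W ↪ W') (H : X → Y) (ψ : EuclideanSpace ℂ (X × Y × W)) :
    oracle H (push (workEmb X Y j) ψ) = push (workEmb X Y j) (oracle H ψ) := by
  ext ⟨x, y, w'⟩
  rw [oracle_apply]
  by_cases h : ∃ w, j w = w'
  · obtain ⟨w, rfl⟩ := h
    rw [push_apply_of_eq (workEmb X Y j) ψ (workEmb_apply j x (y - H x) w),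
      push_apply_of_eq (workEmb X Y j) _ (workEmb_apply j x y w), oracle_apply]
  · push Not at h
    rw [push_apply_of_forall_ne, push_apply_of_forall_ne]
    all_goals
      rintro ⟨a, b, w⟩ hd
      simp only [workEmb_apply, Prod.mk.injEq] at hd
      exact h w hd.2.2

namespace QueryCircuit

/-- A circuit followed by a local unitary. -/
noncomputable def post (C : QueryCircuit X Y W) (U : UnitaryOp (X × Y × W)) : QueryCircuit X Y W :=
  match C with
  | start V => start (V.trans U)
  | step C V => step C (V.trans U)

theorem post_run (C : QueryCircuit X Y W) (U : UnitaryOp (X × Y × W)) (H : X → Y)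
    (ψ : EuclideanSpace ℂ (X × Y × W)) : (C.post U).run H ψ = U (C.run H ψ) := by
  cases C <;> rfl

theorem post_numQueries (C : QueryCircuit X Y W) (U : UnitaryOp (X × Y × W)) :
    (C.post U).numQueries = C.numQueries := by
  cases C <;> rfl

/-- The oracle ignores the work register, so it suffices to extend each local unitary from the
embedded subspace. Its action off that subspace is irrelevant and left arbitrary. -/
theorem exists_lift (j : W ↪ W') (C : QueryCircuit X Y W) :
    ∃ C' : QueryCircuit X Y W', C'.numQueries = C.numQueries ∧
      ∀ H ψ, C'.run H (push (workEmb X Y j) ψ) = push (workEmb X Y j) (C.run H ψ) := by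
  have lift (U : UnitaryOp (X × Y × W)) : ∃ U' : UnitaryOp (X × Y × W'),
      ∀ ψ, U' (push (workEmb X Y j) ψ) = push (workEmb X Y j) (U ψ) :=
    exists_unitaryOp (push (workEmb X Y j)) ((push (workEmb X Y j)).comp U.toLinearIsometry)
  induction C with
  | start U =>
    obtain ⟨U', hU'⟩ := lift U
    exact ⟨start U', rfl, fun H ψ => hU' ψ⟩
  | step C U ih =>
    obtain ⟨U', hU'⟩ := lift U
    obtain ⟨C', hq, hC'⟩ := ih
    refine ⟨step C' U', by simp [numQueries, hq], fun H ψ => ?_⟩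
    simp only [run, LinearIsometryEquiv.trans_apply]
    rw [hC', oracle_push, hU']

end QueryCircuit

theorem inner_push_inr_inl (κ : EuclideanSpace ℂ (X × Y × Z)) (s : EuclideanSpace ℂ (X × Y × W)) :
    inner ℂ (push (workEmb X Y (Function.Embedding.inr (α := W))) κ)
      (push (workEmb X Y (Function.Embedding.inl (β := Z))) s) = 0 := by
  apply inner_push_push_eq_zero
  rintro ⟨x, y, z⟩ ⟨x', y', w⟩ h
  simp at h

/-- The part of a state captured by an isometry `ι` can be moved coherently into a fresh summand of
the work register, the rest being left in place. -/
theorem exists_move {D : Type} [Fintype D]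
    (ι : EuclideanSpace ℂ D →ₗᵢ[ℂ] EuclideanSpace ℂ (X × Y × W))
    (κ : EuclideanSpace ℂ D →ₗᵢ[ℂ] EuclideanSpace ℂ (X × Y × Z)) :
    ∃ U : UnitaryOp (X × Y × (W ⊕ Z)), ∀ s,
      U (push (workEmb X Y Function.Embedding.inl) s) =
        push (workEmb X Y Function.Embedding.inr) (κ (adj ι s)) +
          push (workEmb X Y Function.Embedding.inl) (s - ι (adj ι s)) := by
  let T : EuclideanSpace ℂ (X × Y × W) →ₗ[ℂ] EuclideanSpace ℂ (X × Y × (W ⊕ Z)) :=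
    (push (workEmb X Y Function.Embedding.inr)).toLinearMap ∘ₗ κ.toLinearMap ∘ₗ
      (adj ι).toLinearMap +
    (push (workEmb X Y Function.Embedding.inl)).toLinearMap ∘ₗ
      (LinearMap.id - ι.toLinearMap ∘ₗ (adj ι).toLinearMap)
  have hT : ∀ s, T s = push (workEmb X Y Function.Embedding.inr) (κ (adj ι s)) +
      push (workEmb X Y Function.Embedding.inl) (s - ι (adj ι s)) := fun s => rfl
  -- Pythagoras twice: `s` splits orthogonally into its projection on the range of `ι` and the
  -- remainder, and `T` sends the two parts isometrically into orthogonal summands.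
  have hnorm : ∀ s, ‖T s‖ = ‖s‖ := by
    intro s
    have h1 := norm_add_sq_eq_norm_sq_add_norm_sq_of_inner_eq_zero (𝕜 := ℂ) _ _
      (inner_push_inr_inl (κ (adj ι s)) (s - ι (adj ι s)))
    have h2 : inner ℂ (ι (adj ι s)) (s - ι (adj ι s)) = 0 := by
      rw [← adj_inner, map_sub, adj_apply_self, sub_self, inner_zero_right]
    have h3 := norm_add_sq_eq_norm_sq_add_norm_sq_of_inner_eq_zero (𝕜 := ℂ) _ _ h2
    rw [add_sub_cancel] at h3
    rw [← hT] at h1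
    simp only [LinearIsometry.norm_map] at h1 h3
    nlinarith [norm_nonneg (T s), norm_nonneg s]
  obtain ⟨U, hU⟩ := exists_unitaryOp (push (workEmb X Y Function.Embedding.inl)) ⟨T, hnorm⟩
  exact ⟨U, hU⟩

end Circuits

/-! ### States prepared with few queries, up to postselection -/

section Preparable

variable {X Y : Type} [Fintype X] [AddCommGroup Y] [Fintype Y]
variable {D D' D'' : Type} [Fintype D] [Fintype D'] [Fintype D'']

/-- The family `φ` of (subnormalized) states is obtained with at most `q` queries: a circuit started
in a basis state produces states whose component along a fixed isometric embedding is `φ`. -/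
def Preparable (q : ℕ) (φ : (X → Y) → EuclideanSpace ℂ D) : Prop :=
  ∃ (W : Type) (_ : Fintype W) (b₀ : X × Y × W) (C : QueryCircuit X Y W)
    (ι : EuclideanSpace ℂ D →ₗᵢ[ℂ] EuclideanSpace ℂ (X × Y × W)),
    C.numQueries ≤ q ∧ ∀ H, adj ι (C.run H (ket b₀)) = φ H

theorem preparable_single [Nonempty X] (d : D) :
    Preparable 0 fun _ : X → Y => ket d := by
  obtain ⟨x₀⟩ := ‹Nonempty X›
  let j : D ↪ X × Y × D := ⟨fun d => (x₀, 0, d), fun a b h => by simpa using h⟩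
  refine ⟨D, inferInstance, j d, .start (LinearIsometryEquiv.refl ℂ _), push j, le_rfl,
    fun H => ?_⟩
  have : QueryCircuit.run H (.start (LinearIsometryEquiv.refl ℂ _))
      (ket (j d)) = push j (ket d) :=
    (push_ket j d).symm
  rw [this, adj_apply_self]

/-- A preparable family can be placed in a summand of the work register of our choice. -/
theorem Preparable.exists_circuit {q : ℕ} {φ : (X → Y) → EuclideanSpace ℂ D} (h : Preparable q φ)
    {Z : Type} [Fintype Z] (κ : EuclideanSpace ℂ D →ₗᵢ[ℂ] EuclideanSpace ℂ (X × Y × Z)) :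
    ∃ (W : Type) (_ : Fintype W) (b₀ : X × Y × (W ⊕ Z)) (C : QueryCircuit X Y (W ⊕ Z))
      (rest : (X → Y) → EuclideanSpace ℂ (X × Y × W)), C.numQueries ≤ q ∧
      ∀ H, C.run H (ket b₀) =
        push (workEmb X Y Function.Embedding.inr) (κ (φ H)) +
          push (workEmb X Y Function.Embedding.inl) (rest H) := by
  obtain ⟨W, hW, b₀, C, ι, hq, hC⟩ := h
  obtain ⟨C', hq', hC'⟩ := C.exists_lift (Function.Embedding.inl (α := W) (β := Z))
  obtain ⟨U, hU⟩ := exists_move ι κ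
  refine ⟨W, hW, workEmb X Y Function.Embedding.inl b₀, C'.post U,
    fun H => C.run H (ket b₀) - ι (φ H), by rw [C'.post_numQueries, hq']; exact hq, fun H => ?_⟩
  rw [QueryCircuit.post_run, ← push_ket, hC', hU, hC]

/-- The two summands of the work register are orthogonal, so the residual part in the left one is
invisible to the adjoint. -/
theorem adj_comp_push_inr {W Z : Type} [Fintype W] [Fintype Z]
    (κ : EuclideanSpace ℂ D →ₗᵢ[ℂ] EuclideanSpace ℂ (X × Y × Z)) (φ : EuclideanSpace ℂ D)
    (s : EuclideanSpace ℂ (X × Y × W)) :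
    adj ((push (workEmb X Y Function.Embedding.inr)).comp κ)
      (push (workEmb X Y Function.Embedding.inr) (κ φ) +
        push (workEmb X Y Function.Embedding.inl) s) = φ := by
  refine ext_inner_left ℂ fun y => ?_
  rw [adj_inner, inner_add_right]
  have hy : (push (workEmb X Y (Function.Embedding.inr (α := W)))).comp κ y =
      push (workEmb X Y Function.Embedding.inr) (κ y) := rfl
  rw [hy, inner_push_inr_inl, LinearIsometry.inner_map_map, LinearIsometry.inner_map_map, add_zero]

theorem Preparable.isometry [Nonempty X] {q : ℕ} {φ : (X → Y) → EuclideanSpace ℂ D}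
    (h : Preparable q φ) (L : EuclideanSpace ℂ D →ₗᵢ[ℂ] EuclideanSpace ℂ D') :
    Preparable q fun H => L (φ H) := by
  obtain ⟨x₀⟩ := ‹Nonempty X›
  let j : D' ↪ X × Y × D' := ⟨fun d => (x₀, 0, d), fun a b h => by simpa using h⟩
  obtain ⟨W, hW, b₀, C, rest, hq, hC⟩ := h.exists_circuit ((push j).comp L)
  refine ⟨_, inferInstance, b₀, C, (push (workEmb X Y Function.Embedding.inr)).comp (push j), hq,
    fun H => ?_⟩
  rw [hC]
  exact adj_comp_push_inr (push j) (L (φ H)) (rest H)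

/-- Projecting is free: it only narrows the embedding along which the component is read, from `ι` to
`ι ∘ L`. This is the source of postselection. -/
theorem Preparable.adj_isometry {q : ℕ} {φ : (X → Y) → EuclideanSpace ℂ D'}
    (h : Preparable q φ) (L : EuclideanSpace ℂ D →ₗᵢ[ℂ] EuclideanSpace ℂ D') :
    Preparable q fun H => adj L (φ H) := by
  obtain ⟨W, hW, b₀, C, ι, hq, hC⟩ := h
  refine ⟨W, hW, b₀, C, ι.comp L, hq, fun H => ?_⟩
  refine ext_inner_left ℂ fun y => ?_
  rw [adj_inner, adj_inner, ← hC, adj_inner]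
  rfl

theorem Preparable.mono {q q' : ℕ} {φ : (X → Y) → EuclideanSpace ℂ D}
    (h : Preparable q φ) (hqq : q ≤ q') : Preparable q' φ := by
  obtain ⟨W, hW, b₀, C, ι, hq, hC⟩ := h
  exact ⟨W, hW, b₀, C, ι, hq.trans hqq, hC⟩

/-- An operation which an isometry `κ` intertwines with the oracle costs one query. -/
theorem Preparable.query {q : ℕ} {φ : (X → Y) → EuclideanSpace ℂ D} (h : Preparable q φ)
    {Z : Type} [Fintype Z] (κ : EuclideanSpace ℂ D →ₗᵢ[ℂ] EuclideanSpace ℂ (X × Y × Z))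
    (G : (X → Y) → EuclideanSpace ℂ D →L[ℂ] EuclideanSpace ℂ D)
    (hG : ∀ H ψ, oracle H (κ ψ) = κ (G H ψ)) : Preparable (q + 1) fun H => G H (φ H) := by
  obtain ⟨W, hW, b₀, C, rest, hq, hC⟩ := h.exists_circuit κ
  refine ⟨_, inferInstance, b₀, C.step (LinearIsometryEquiv.refl ℂ _),
    (push (workEmb X Y Function.Embedding.inr)).comp κ, by simpa [QueryCircuit.numQueries] using hq,
    fun H => ?_⟩
  simp only [QueryCircuit.run, LinearIsometryEquiv.trans_apply, LinearIsometryEquiv.coe_refl, id]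
  rw [hC, map_add, oracle_push, oracle_push, hG]
  exact adj_comp_push_inr κ _ _

end Preparable

/-! ### Operators with a query cost, and controlled queries -/

section Simulable

variable {X Y : Type} [Fintype X] [AddCommGroup Y] [Fintype Y]
variable {D D' D'' : Type} [Fintype D] [Fintype D'] [Fintype D'']

/-- The family `V` of operators and the family of its adjoints can be applied to preparable states
at the cost of `t` queries. -/
def Simulable (t : ℕ) (V : (X → Y) → EuclideanSpace ℂ D →L[ℂ] EuclideanSpace ℂ D') : Prop :=
  (∀ q φ, Preparable q φ → Preparable (q + t) fun H => V H (φ H)) ∧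
  ∀ q φ, Preparable q φ → Preparable (q + t) fun H => ContinuousLinearMap.adjoint (V H) (φ H)

theorem Simulable.adjoint {t : ℕ} {V : (X → Y) → EuclideanSpace ℂ D →L[ℂ] EuclideanSpace ℂ D'}
    (h : Simulable t V) : Simulable t fun H => ContinuousLinearMap.adjoint (V H) :=
  ⟨h.2, by simpa using h.1⟩

theorem Simulable.comp {s t : ℕ} {V : (X → Y) → EuclideanSpace ℂ D →L[ℂ] EuclideanSpace ℂ D'}
    {V' : (X → Y) → EuclideanSpace ℂ D' →L[ℂ] EuclideanSpace ℂ D''}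
    (h' : Simulable t V') (h : Simulable s V) : Simulable (s + t) fun H => (V' H).comp (V H) := by
  refine ⟨fun q φ hφ => ?_, fun q φ hφ => ?_⟩
  · rw [← add_assoc]
    exact h'.1 _ _ (h.1 _ _ hφ)
  · rw [add_comm s t, ← add_assoc]
    simp only [ContinuousLinearMap.adjoint_comp]
    exact h.2 _ _ (h'.2 _ _ hφ)

theorem Simulable.mono {s t : ℕ} {V : (X → Y) → EuclideanSpace ℂ D →L[ℂ] EuclideanSpace ℂ D'}
    (h : Simulable s V) (hst : s ≤ t) : Simulable t V :=
  ⟨fun q φ hφ => (h.1 q φ hφ).mono (by lia), fun q φ hφ => (h.2 q φ hφ).mono (by lia)⟩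

theorem simulable_isometry [Nonempty X] (L : EuclideanSpace ℂ D →ₗᵢ[ℂ] EuclideanSpace ℂ D') :
    Simulable 0 fun _ : X → Y => L.toContinuousLinearMap :=
  ⟨fun _ _ h => h.isometry L, fun _ _ h => h.adj_isometry L⟩

/-- The permutation `(c, y) ↦ (c, y + H x)` if `g c = some x`, and the identity where
`g c = none`. -/
def ctrlQueryPerm {C : Type} (g : C → Option X) (H : X → Y) : Equiv.Perm (C × Y) where
  toFun b := (b.1, b.2 + (g b.1).elim 0 H)
  invFun b := (b.1, b.2 - (g b.1).elim 0 H)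
  left_inv b := by simp
  right_inv b := by simp

/-- The query unitary whose query point, if any, is computed from a register `C`. -/
noncomputable def ctrlQuery {C : Type} [Fintype C] (g : C → Option X) (H : X → Y) :
    UnitaryOp (C × Y) :=
  LinearIsometryEquiv.piLpCongrLeft 2 ℂ ℂ (ctrlQueryPerm g H)

theorem ctrlQuery_apply {C : Type} [Fintype C] (g : C → Option X) (H : X → Y)
    (ψ : EuclideanSpace ℂ (C × Y)) (c : C) (y : Y) :
    ctrlQuery g H ψ (c, y) = ψ (c, y - (g c).elim 0 H) := rfl

theorem ctrlQuery_symm_apply {C : Type} [Fintype C] (g : C → Option X) (H : X → Y)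
    (ψ : EuclideanSpace ℂ (C × Y)) (c : C) (y : Y) :
    (ctrlQuery g H).symm ψ (c, y) = ψ (c, y + (g c).elim 0 H) := by
  rw [ctrlQuery, LinearIsometryEquiv.piLpCongrLeft_symm]
  rfl

open Classical in
/-- Embeds the register of a controlled query into the registers of a query circuit: the query point
is written to `X` where there is one; elsewhere `Y` is put in the uniform superposition, on which
the oracle acts trivially. -/
noncomputable def ctrlEmb {C : Type} [Fintype C] (x₀ : X) (g : C → Option X) :
    EuclideanSpace ℂ (C × Y) →ₗᵢ[ℂ] EuclideanSpace ℂ (X × Y × (C ⊕ C × Y)) where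
  toFun ψ := WithLp.toLp 2 fun b => match b with
    | (x, y, .inl c) => if g c = some x then ψ (c, y) else 0
    | (x, _, .inr c) => if g c.1 = none ∧ x = x₀ then ψ c / (√(Fintype.card Y) : ℝ) else 0
  map_add' ψ φ := by
    ext ⟨x, y, c | c⟩ <;> simp only [PiLp.add_apply] <;> split_ifs <;> simp [add_div]
  map_smul' a ψ := by
    ext ⟨x, y, c | c⟩ <;> simp only [PiLp.smul_apply, smul_eq_mul, RingHom.id_apply] <;>
      split_ifs <;> simp [mul_div_assoc]
  norm_map' ψ := by
    rw [EuclideanSpace.norm_eq, EuclideanSpace.norm_eq]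
    congr 1
    have hcard : (Fintype.card Y : ℝ) ≠ 0 := by simp
    have h1 : ∀ (c : C) (y : Y), (∑ x : X, ‖if g c = some x then ψ (c, y) else 0‖ ^ 2) =
        if g c = none then 0 else ‖ψ (c, y)‖ ^ 2 := by
      intro c y
      cases hc : g c with
      | none => simp
      | some x => simp [apply_ite, Finset.sum_ite_eq]
    have h2 : ∀ c : C × Y, (∑ x : X, ∑ _y : Y,
        ‖if g c.1 = none ∧ x = x₀ then ψ c / (√(Fintype.card Y) : ℝ) else 0‖ ^ 2) =
        if g c.1 = none then ‖ψ c‖ ^ 2 else 0 := by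
      intro c
      by_cases hc : g c.1 = none
      · simp only [hc, true_and, if_true, Finset.sum_const, Finset.card_univ, nsmul_eq_mul]
        rw [Finset.sum_eq_single x₀ (by intro x _ hx; simp [hx]) (by simp)]
        simp [div_pow, mul_div_cancel₀, hcard]
      · simp [hc]
    calc _ = ∑ x : X, ∑ y : Y, ((∑ c : C, ‖if g c = some x then ψ (c, y) else 0‖ ^ 2) +
          ∑ c : C × Y,
            ‖if g c.1 = none ∧ x = x₀ then ψ c / (√(Fintype.card Y) : ℝ) else 0‖ ^ 2) := by
          simp only [Fintype.sum_prod_type, Fintype.sum_sum_type]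
          rfl
      _ = (∑ c : C, ∑ y : Y, ∑ x : X, ‖if g c = some x then ψ (c, y) else 0‖ ^ 2) +
          ∑ c : C × Y, ∑ x : X, ∑ _y : Y,
            ‖if g c.1 = none ∧ x = x₀ then ψ c / (√(Fintype.card Y) : ℝ) else 0‖ ^ 2 := by
          simp only [Finset.sum_add_distrib]
          congr 1
          · rw [Finset.sum_comm]
            conv_rhs => rw [Finset.sum_comm]
            refine Finset.sum_congr rfl fun y _ => ?_
            rw [Finset.sum_comm]
          · conv_rhs => rw [Finset.sum_comm]
            refine Finset.sum_congr rfl fun x _ => ?_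
            rw [Finset.sum_comm]
      _ = _ := by
          simp only [h1, h2]
          rw [Fintype.sum_prod_type, Fintype.sum_prod_type, ← Finset.sum_add_distrib]
          refine Finset.sum_congr rfl fun c _ => ?_
          rw [← Finset.sum_add_distrib]
          refine Finset.sum_congr rfl fun y _ => ?_
          split_ifs <;> simp

/-- Where `g` gives a point, the oracle acts as the intended query. Elsewhere `Y` is uniform, hence
invariant under translation. -/
theorem oracle_ctrlEmb {C : Type} [Fintype C] (x₀ : X) (g : C → Option X) (H : X → Y)
    (ψ : EuclideanSpace ℂ (C × Y)) :
    oracle H (ctrlEmb x₀ g ψ) = ctrlEmb x₀ g (ctrlQuery g H ψ) := by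
  ext ⟨x, y, c | ⟨c, y'⟩⟩
  · rw [oracle_apply]
    by_cases hc : g c = some x <;> simp [ctrlEmb, ctrlQuery_apply, hc]
  · rw [oracle_apply]
    by_cases hc : g c = none <;> simp [ctrlEmb, ctrlQuery_apply, hc]

theorem simulable_ctrlQuery [Nonempty X] {C : Type} [Fintype C] (g : C → Option X) :
    Simulable 1 fun H : X → Y =>
      (ctrlQuery g H).toLinearIsometry.toContinuousLinearMap := by
  obtain ⟨x₀⟩ := id ‹Nonempty X›
  have fwd : ∀ q (φ : (X → Y) → EuclideanSpace ℂ (C × Y)), Preparable q φ →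
      Preparable (q + 1) fun H => ctrlQuery g H (φ H) := fun q φ h =>
    h.query (ctrlEmb x₀ g) (fun H => (ctrlQuery g H).toLinearIsometry.toContinuousLinearMap)
      fun H ψ => oracle_ctrlEmb x₀ g H ψ
  refine ⟨fwd, fun q φ h => ?_⟩
  -- Conjugating with `y ↦ -y` turns addition of the oracle value into subtraction, so the adjoint
  -- also costs one forward query.
  let N : EuclideanSpace ℂ (C × Y) →ₗᵢ[ℂ] EuclideanSpace ℂ (C × Y) :=
    (LinearIsometryEquiv.piLpCongrLeft 2 ℂ ℂ
      ((Equiv.refl C).prodCongr (Equiv.neg Y))).toLinearIsometry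
  have hN : ∀ ψ c y, N ψ (c, y) = ψ (c, -y) := fun ψ c y => rfl
  have := (fwd q _ (h.isometry N)).isometry N
  convert this using 2 with H
  have h1 : ContinuousLinearMap.adjoint
      (ctrlQuery g H).toLinearIsometry.toContinuousLinearMap =
      (ctrlQuery g H).symm.toLinearIsometry.toContinuousLinearMap :=
    LinearIsometryEquiv.adjoint_eq_symm (ctrlQuery g H)
  rw [h1]
  ext ⟨c, y⟩
  rw [hN, ctrlQuery_apply, hN]
  change (ctrlQuery g H).symm (φ H) (c, y) = _
  rw [ctrlQuery_symm_apply]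
  rw [neg_sub, sub_neg_eq_add, add_comm]

end Simulable

/-! ### Coherent evaluation of classical oracle algorithms -/

section Classical

variable {X Y : Type} [Fintype X] [AddCommGroup Y] [Fintype Y]

/-- The injection `(c, k) ↦ ((c, t c), k)` of basis labels. -/
def graphEmb {C Z : Type} (K : Type) (t : C → Z) : C × K ↪ (C × Z) × K where
  toFun b := ((b.1, t b.1), b.2)
  inj' := by
    rintro ⟨c, k⟩ ⟨c', k'⟩ h
    simp only [Prod.mk.injEq] at h
    exact Prod.ext h.1.1 h.2

theorem graphEmb_apply {C Z K : Type} (t : C → Z) (c : C) (k : K) :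
    graphEmb K t (c, k) = ((c, t c), k) := rfl

theorem ctrlQuery_eq_push {C : Type} [Fintype C] (g : C → Option X) (H : X → Y)
    (ψ : EuclideanSpace ℂ (C × Y)) :
    ctrlQuery g H ψ = push (ctrlQueryPerm g H).toEmbedding ψ := by
  ext ⟨c, y⟩
  rw [ctrlQuery_apply]
  refine (push_apply_of_eq _ ψ ?_).symm
  simp [ctrlQueryPerm]

/-- A classical oracle algorithm can be evaluated coherently, the answers to its queries being
recorded in a transcript `t H c` from which the output is read off. -/
theorem exists_transcript [Nonempty X] {α : Type} (n : ℕ) :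
    ∀ (C : Type) [Fintype C] (alg : C → OracleAlg X Y α),
      ∃ (Z : Type) (_ : Fintype Z) (t : (X → Y) → C → Z) (read : C × Z → Option α),
        (∀ H c, (alg c).numQueries H ≤ n → read (c, t H c) = some ((alg c).eval H)) ∧
        ∀ (K : Type) [Fintype K],
          Simulable n fun H => (push (graphEmb K (t H))).toContinuousLinearMap := by
  induction n with
  | zero =>
    intro C _ alg
    refine ⟨Unit, inferInstance, fun _ _ => (), fun b => match alg b.1 with
      | .ret a => some a
      | .query _ _ => none, fun H c hq => ?_, fun K _ => ?_⟩
    · cases h : alg c with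
      | ret a => simp [h, OracleAlg.eval]
      | query x next => simp [h, OracleAlg.numQueries] at hq
    · exact simulable_isometry (push (graphEmb K fun _ => ()))
  | succ n ih =>
    intro C _ alg
    -- The induction peels off the first query of every branch at once. A branch that has already
    -- returned makes an idle query with recorded answer `0`, and `alg'` is the algorithm that
    -- remains once the answer is known.
    let pt : C → Option X := fun c => match alg c with
      | .ret _ => none
      | .query x _ => some x
    let alg' : C × Y → OracleAlg X Y α := fun b => match alg b.1 with
      | .ret a => .ret a
      | .query _ next => next b.2
    obtain ⟨Z, hZ, t, read, hread, hsim⟩ := ih (C × Y) alg'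
    let y : (X → Y) → C → Y := fun H c => (pt c).elim 0 H
    refine ⟨Y × Z, inferInstance, fun H c => (y H c, t H (c, y H c)),
      fun b => read ((b.1, b.2.1), b.2.2), fun H c hq => ?_, fun K _ => ?_⟩
    · simp only
      cases h : alg c with
      | ret a =>
        have h' : alg' (c, y H c) = .ret a := by simp [alg', h]
        rw [hread _ _ (by simp [h', OracleAlg.numQueries]), h']
      | query x next =>
        have h' : alg' (c, y H c) = next (H x) := by simp [alg', y, pt, h]
        rw [h, OracleAlg.numQueries] at hq
        rw [hread _ _ (by rw [h']; lia), h']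
        rfl
    · let init : C × K ↪ (C × K) × Y := ⟨fun b => (b, 0), fun a b h => by simpa using h⟩
      let e₁ : (C × K) × Y ↪ (C × Y) × K :=
        ⟨fun b => ((b.1.1, b.2), b.1.2), by rintro ⟨⟨_, _⟩, _⟩ ⟨⟨_, _⟩, _⟩ h; simp_all⟩
      let e₂ : ((C × Y) × Z) × K ↪ (C × Y × Z) × K :=
        ⟨fun b => ((b.1.1.1, b.1.1.2, b.1.2), b.2),
          by rintro ⟨⟨⟨_, _⟩, _⟩, _⟩ ⟨⟨⟨_, _⟩, _⟩, _⟩ h; simp_all⟩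
      have h := (simulable_isometry (X := X) (Y := Y) (push e₂)).comp ((hsim K).comp
        ((simulable_isometry (push e₁)).comp
          ((simulable_ctrlQuery (Y := Y) fun b : C × K => pt b.1).comp
            (simulable_isometry (push init)))))
      rw [show 0 + 1 + 0 + n + 0 = n + 1 by lia] at h
      convert h using 2 with H
      ext1 ψ
      change push (graphEmb K fun c => (y H c, t H (c, y H c))) ψ = push e₂
        (push (graphEmb K (t H)) (push e₁ (ctrlQuery (fun b : C × K => pt b.1) H (push init ψ))))
      rw [ctrlQuery_eq_push, push_push, push_push, push_push, push_push]
      congr 2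
      ext1 ⟨c, k⟩
      change ((c, y H c, t H (c, y H c)), k) = ((c, 0 + y H c, t H (c, 0 + y H c)), k)
      rw [zero_add]

end Classical

/-! ### Unitaries selected by a control register -/

section BlockDiag

variable {D B : Type} [Fintype D] [Fintype B]

/-- The component of a state where the control register contains `d`. -/
def slice (d : D) (ψ : EuclideanSpace ℂ (D × B)) : EuclideanSpace ℂ B :=
  WithLp.toLp 2 fun b => ψ (d, b)

theorem slice_apply (d : D) (ψ : EuclideanSpace ℂ (D × B)) (b : B) : slice d ψ b = ψ (d, b) := rfl

theorem slice_add (d : D) (ψ φ : EuclideanSpace ℂ (D × B)) :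
    slice d (ψ + φ) = slice d ψ + slice d φ := rfl

theorem slice_smul (d : D) (a : ℂ) (ψ : EuclideanSpace ℂ (D × B)) :
    slice d (a • ψ) = a • slice d ψ := rfl

/-- The unitary acting as `U d` where the control register contains `d`. -/
noncomputable def blockDiag (U : D → UnitaryOp B) : UnitaryOp (D × B) where
  toFun ψ := WithLp.toLp 2 fun b => U b.1 (slice b.1 ψ) b.2
  invFun ψ := WithLp.toLp 2 fun b => (U b.1).symm (slice b.1 ψ) b.2
  left_inv ψ := by
    ext ⟨d, b⟩
    change (U d).symm (U d (slice d ψ)) b = _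
    rw [LinearIsometryEquiv.symm_apply_apply]
    rfl
  right_inv ψ := by
    ext ⟨d, b⟩
    change U d ((U d).symm (slice d ψ)) b = _
    rw [LinearIsometryEquiv.apply_symm_apply]
    rfl
  map_add' ψ φ := by
    ext ⟨d, b⟩
    simp [slice_add]
  map_smul' a ψ := by
    ext ⟨d, b⟩
    simp [slice_smul]
  norm_map' ψ := by
    rw [EuclideanSpace.norm_eq, EuclideanSpace.norm_eq, Fintype.sum_prod_type,
      Fintype.sum_prod_type]
    congr 1
    refine Finset.sum_congr rfl fun d _ => ?_
    have h := (U d).norm_map (slice d ψ)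
    rw [EuclideanSpace.norm_eq, EuclideanSpace.norm_eq, Real.sqrt_inj (by positivity)
      (by positivity)] at h
    exact h

theorem blockDiag_apply (U : D → UnitaryOp B) (ψ : EuclideanSpace ℂ (D × B)) (d : D) (b : B) :
    blockDiag U ψ (d, b) = U d (slice d ψ) b := rfl

end BlockDiag

/-! ### Circuits selected by a control register -/

section ControlledCircuit

variable {X Y W D : Type} [Fintype X] [AddCommGroup Y] [Fintype Y] [Fintype W] [Fintype D]

/-- Queries switched on or off by a control register cost a single query. -/
theorem simulable_blockDiag_oracle [Nonempty X] (p : D → Prop) [DecidablePred p] :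
    Simulable 1 fun H : X → Y => (blockDiag (D := D) (B := X × Y × W) fun d =>
      if p d then oracle H else LinearIsometryEquiv.refl ℂ _).toLinearIsometry.toContinuousLinearMap
    := by
  let e : D × (X × Y × W) ≃ (D × X × W) × Y :=
    ⟨fun b => ((b.1, b.2.1, b.2.2.2), b.2.2.1), fun b => (b.1.1, b.1.2.1, b.2, b.1.2.2),
      fun _ => rfl, fun _ => rfl⟩
  let g : D × X × W → Option X := fun c => if p c.1 then some c.2.1 else none
  have h := ((simulable_isometry (push e.symm.toEmbedding)).comp
    ((simulable_ctrlQuery (Y := Y) g).comp (simulable_isometry (push e.toEmbedding))))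
  rw [zero_add, add_zero] at h
  convert h using 2 with H
  ext ψ ⟨d, x, y, w⟩
  have h1 (φ : EuclideanSpace ℂ ((D × X × W) × Y)) :
      push e.symm.toEmbedding φ (d, x, y, w) = φ ((d, x, w), y) :=
    push_apply_of_eq e.symm.toEmbedding φ rfl
  have h2 (y' : Y) : push e.toEmbedding ψ ((d, x, w), y') = ψ (d, x, y', w) :=
    push_apply_of_eq (d := (d, x, y', w)) e.toEmbedding ψ rfl
  change blockDiag (fun d => if p d then oracle H else LinearIsometryEquiv.refl ℂ _) ψ (d, x, y, w) =
    push e.symm.toEmbedding (ctrlQuery g H (push e.toEmbedding ψ)) (d, x, y, w)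
  rw [h1, ctrlQuery_apply, h2, blockDiag_apply]
  by_cases hd : p d
  · simp [hd, g, slice_apply]
  · simp [hd, g, slice_apply]

/-- Circuits with at most `T` queries selected by a control register cost `T` queries. -/
theorem simulable_blockDiag_run [Nonempty X] (T : ℕ) :
    ∀ C : D → QueryCircuit X Y W, (∀ d, (C d).numQueries ≤ T) →
      Simulable T fun H : X → Y =>
        (blockDiag fun d => (C d).run H).toLinearIsometry.toContinuousLinearMap := by
  classical
  induction T with
  | zero =>
    intro C hC
    have : ∀ d, ∃ U, C d = .start U := by
      intro d
      cases h : C d with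
      | start U => exact ⟨U, rfl⟩
      | step C' U =>
        have := hC d
        simp [h, QueryCircuit.numQueries] at this
    choose U hU using this
    simp only [hU, QueryCircuit.run]
    exact simulable_isometry _
  | succ T ih =>
    intro C hC
    -- Peel off the last query. A circuit without queries is given one that is switched off, so that
    -- all branches share one controlled query.
    have : ∀ d, ∃ (C' : QueryCircuit X Y W) (p : Prop) (U : UnitaryOp (X × Y × W)),
        C'.numQueries ≤ T ∧ ∀ H ψ, (C d).run H ψ =
          U ((if p then oracle H else LinearIsometryEquiv.refl ℂ _) (C'.run H ψ)) := by
      intro d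
      cases h : C d with
      | start U =>
        exact ⟨.start U, False, LinearIsometryEquiv.refl ℂ _, by simp [QueryCircuit.numQueries],
          fun H ψ => by simp⟩
      | step C' U =>
        have := hC d
        rw [h] at this
        exact ⟨C', True, U, by simpa [QueryCircuit.numQueries] using this,
          fun H ψ => by simp [QueryCircuit.run]⟩
    choose C' p U hq hrun using this
    have h := (simulable_isometry (X := X) (Y := Y) (blockDiag U).toLinearIsometry).comp
      ((simulable_blockDiag_oracle (X := X) (Y := Y) (W := W) p).comp (ih C' hq))
    rw [add_zero] at h
    convert h using 2 with H
    ext ψ ⟨d, b⟩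
    exact congrArg (fun v : EuclideanSpace ℂ (X × Y × W) => v b) (hrun d H (slice d ψ))

end ControlledCircuit

/-! ### The winning operator of a game -/

section WinOperator

theorem norm_sq_adj_push_subtype {D : Type} [Fintype D] (p : D → Prop) [DecidablePred p]
    (ψ : EuclideanSpace ℂ D) :
    ‖adj (push (Function.Embedding.subtype p)) ψ‖ ^ 2 = ∑ d, if p d then ‖ψ d‖ ^ 2 else 0 := by
  rw [EuclideanSpace.norm_sq_eq, ← Finset.sum_filter, Finset.sum_subtype (p := p) _ (by simp)]
  simp only [adj_push]
  rfl

/-- The isometry `ψ ↦ |R|^{-1/2} ∑ r, |r⟩ ⊗ ψ`. -/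
noncomputable def spread (R : Type) [Fintype R] [Nonempty R] {B : Type} [Fintype B] :
    EuclideanSpace ℂ B →ₗᵢ[ℂ] EuclideanSpace ℂ (R × B) where
  toFun ψ := WithLp.toLp 2 fun b => ((√(Fintype.card R))⁻¹ : ℝ) * ψ b.2
  map_add' ψ φ := by
    ext b
    simp [mul_add]
  map_smul' a ψ := by
    ext b
    simp [mul_left_comm]
  norm_map' ψ := by
    rw [EuclideanSpace.norm_eq, EuclideanSpace.norm_eq, Fintype.sum_prod_type]
    congr 1
    have : (Fintype.card R : ℝ) ≠ 0 := by simp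
    simp [mul_pow, ← Finset.mul_sum, this]

theorem slice_spread {R : Type} [Fintype R] [Nonempty R] {B : Type} [Fintype B]
    (ψ : EuclideanSpace ℂ B) (r : R) :
    slice r (spread R ψ) = (((√(Fintype.card R))⁻¹ : ℝ) : ℂ) • ψ := rfl

/-- On the image of `graphEmb` the second control register is determined by the first, so the
selected unitary depends on `d` alone. -/
theorem blockDiag_push_graphEmb {D Z B : Type} [Fintype D] [Fintype Z] [Fintype B] (t : D → Z)
    (U : D × Z → UnitaryOp B) (ψ : EuclideanSpace ℂ (D × B)) :
    blockDiag U (push (graphEmb B t) ψ) =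
      push (graphEmb B t) (blockDiag (fun d => U (d, t d)) ψ) := by
  ext ⟨⟨d, z⟩, b⟩
  rw [blockDiag_apply]
  by_cases h : t d = z
  · subst h
    rw [push_apply_of_eq (graphEmb B t) _ (graphEmb_apply t d b), blockDiag_apply]
    have : slice (d, t d) (push (graphEmb B t) ψ) = slice d ψ := by
      ext b'
      exact push_apply (graphEmb B t) ψ (d, b')
    rw [this]
  · have hne : ∀ b' : B, ∀ a, graphEmb B t a ≠ ((d, z), b') := by
      rintro b' ⟨d', b''⟩ h'
      simp only [graphEmb_apply, Prod.mk.injEq] at h'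
      obtain ⟨⟨rfl, h'⟩, -⟩ := h'
      exact h h'
    have : slice (d, z) (push (graphEmb B t) ψ) = 0 := by
      ext b'
      exact push_apply_of_forall_ne _ _ (hne b')
    rw [this, map_zero, push_apply_of_forall_ne _ _ (hne b)]
    rfl

variable {X Y R Ch Ans W Q : Type} [Fintype X] [AddCommGroup Y] [Fintype Y] [Fintype R]
  [Fintype W] [Fintype Q]

open Classical in
/-- Playing a game coherently, starting from `L σ`, and projecting on the winning outcomes. -/
theorem Game.exists_winOperator [Nonempty X] [Nonempty R] (G : Game X Y R Ch Ans) (T : ℕ)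
    (circuit : Ch → QueryCircuit X Y W) (hT : ∀ ch, (circuit ch).numQueries ≤ T)
    (out : X × Y × W → Ans) (L : EuclideanSpace ℂ Q →ₗᵢ[ℂ] EuclideanSpace ℂ (X × Y × W)) :
    ∃ (F : Type) (_ : Fintype F) (V : (X → Y) → EuclideanSpace ℂ Q →L[ℂ] EuclideanSpace ℂ F),
      Simulable (G.tSamp + T + G.tVerify) V ∧
      ∀ H σ, ‖V H σ‖ ^ 2 = G.winWeight H circuit out (L σ) := by
  obtain ⟨Z, _, t, read, hread, hsim⟩ := exists_transcript G.tSamp R G.samp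
  -- Register contents that decode to no challenge never occur in a transcript; they get the
  -- query-free identity circuit.
  let C : R × Z → QueryCircuit X Y W := fun d =>
    (read d).elim (.start (LinearIsometryEquiv.refl ℂ _)) circuit
  have hC : ∀ d, (C d).numQueries ≤ T := by
    intro d
    cases h : read d with
    | none => simp [C, h, QueryCircuit.numQueries]
    | some ch => simpa [C, h] using hT ch
  obtain ⟨Z', _, t', read', hread', hsim'⟩ := exists_transcript G.tVerify
    ((R × Z) × (X × Y × W)) fun c => G.verify c.1.1 (out c.2)
  -- Winning is read off the verifier's transcript. The transcripts need not be uncomputed, since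
  -- only the norm of the projected state matters.
  let p : (((R × Z) × (X × Y × W)) × Z') × Unit → Prop := fun d => read' d.1 = some true
  let u : (R × Z) × (X × Y × W) ↪ ((R × Z) × (X × Y × W)) × Unit :=
    (Equiv.prodPUnit _).symm.toEmbedding
  refine ⟨{d // p d}, inferInstance, _,
    ((simulable_isometry (X := X) (Y := Y) (push (Function.Embedding.subtype p))).adjoint.comp
      ((hsim' Unit).comp ((simulable_isometry (push u)).comp
        ((simulable_blockDiag_run T C hC).comp ((hsim (X × Y × W)).comp
          ((simulable_isometry (spread R)).comp (simulable_isometry L))))))).mono (by lia), ?_⟩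
  intro H σ
  change ‖adj (push (Function.Embedding.subtype p)) (push (graphEmb Unit (t' H)) (push u
    (blockDiag (fun d => (C d).run H) (push (graphEmb _ (t H)) (spread R (L σ))))))‖ ^ 2 = _
  rw [norm_sq_adj_push_subtype, sum_norm_sq_push, sum_norm_sq_push, blockDiag_push_graphEmb]
  have hp : ∀ c, p (graphEmb Unit (t' H) (u c)) ↔ (G.verify c.1.1 (out c.2)).eval H = true := by
    intro c
    change read' (c, t' H c) = some true ↔ _
    rw [hread' H c (G.verify_queries _ _ _), Option.some_inj]
  simp only [hp]
  rw [sum_norm_sq_push, Fintype.sum_prod_type, Game.winWeight, Finset.sum_div]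
  refine Finset.sum_congr rfl fun r _ => ?_
  rw [Finset.sum_div]
  refine Finset.sum_congr rfl fun b _ => ?_
  change (if (G.verify r (out b)).eval H = true then _ else _) = _
  split_ifs with hv
  · rw [blockDiag_apply, slice_spread]
    have : C (r, t H r) = circuit ((G.samp r).eval H) := by
      simp [C, hread H r (G.samp_queries _ _)]
    rw [this, map_smul, PiLp.smul_apply, norm_smul, mul_pow, Complex.norm_real, Real.norm_eq_abs,
      sq_abs, inv_pow, Real.sq_sqrt (by positivity), inv_mul_eq_div]
  · simp

end WinOperator

/-! ### Log-convex sequences -/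

section LogConvex

variable {a : ℕ → ℝ}

/-- The ratios `a (j+1) / a j` are nondecreasing, so a bound on the last one holds for all earlier
ones, and their product telescopes from `a 0 = 1`. Vanishing terms are handled separately. -/
theorem le_pow_of_logConvex (ha : ∀ j, 0 ≤ a j) (hlc : ∀ j, a (j + 1) ^ 2 ≤ a j * a (j + 2))
    (h0 : a 0 = 1) {ν : ℝ} (hν : 0 ≤ ν) (k : ℕ) (hk : a (k + 1) ≤ ν * a k) :
    a (k + 1) ≤ ν ^ (k + 1) := by
  induction k with
  | zero => simpa [h0] using hk
  | succ k ih =>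
    have h : a (k + 1) ≤ ν * a k := by
      rcases (ha (k + 1)).eq_or_lt with h | h
      · rw [← h]
        exact mul_nonneg hν (ha k)
      · refine le_of_mul_le_mul_right ?_ h
        calc a (k + 1) * a (k + 1) = a (k + 1) ^ 2 := (sq _).symm
          _ ≤ a k * a (k + 2) := hlc k
          _ ≤ a k * (ν * a (k + 1)) := mul_le_mul_of_nonneg_left hk (ha k)
          _ = ν * a k * a (k + 1) := by ring
    calc a (k + 2) ≤ ν * a (k + 1) := hk
      _ ≤ ν * ν ^ (k + 1) := mul_le_mul_of_nonneg_left (ih h) hν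
      _ = ν ^ (k + 2) := by ring

/-- Every ratio is at least the first one, `a 1 / a 0 = a 1`. If some `a j` vanishes, log-convexity
forces `a (j+1) = 0`. -/
theorem pow_le_of_logConvex (ha : ∀ j, 0 ≤ a j) (hlc : ∀ j, a (j + 1) ^ 2 ≤ a j * a (j + 2))
    (h0 : a 0 = 1) (n : ℕ) : a 1 ^ n ≤ a n := by
  have step : ∀ j, a 1 * a j ≤ a (j + 1) := by
    intro j
    induction j with
    | zero => simp [h0]
    | succ j ih =>
      rcases (ha j).eq_or_lt with h | h
      · have : a (j + 1) = 0 := by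
          have := hlc j
          rw [← h, zero_mul] at this
          exact pow_eq_zero_iff two_ne_zero |>.1 (le_antisymm this (sq_nonneg _))
        rw [this, mul_zero]
        exact ha _
      · refine le_of_mul_le_mul_left ?_ h
        calc a j * (a 1 * a (j + 1)) = a 1 * a j * a (j + 1) := by ring
          _ ≤ a (j + 1) * a (j + 1) := mul_le_mul_of_nonneg_right ih (ha _)
          _ = a (j + 1) ^ 2 := (sq _).symm
          _ ≤ a j * a (j + 2) := hlc j
  induction n with
  | zero => simp [h0]
  | succ n ih =>
    calc a 1 ^ (n + 1) = a 1 * a 1 ^ n := pow_succ' _ _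
      _ ≤ a 1 * a n := mul_le_mul_of_nonneg_left ih (ha 1)
      _ ≤ a (n + 1) := step n

end LogConvex

/-! ### Moments of the Gram operator -/

section Moments

open ContinuousLinearMap

variable {I Q F : Type} [Fintype I] [Fintype Q] [Fintype F]

theorem inner_gram_pow (V : EuclideanSpace ℂ Q →L[ℂ] EuclideanSpace ℂ F) (i : ℕ)
    (x y : EuclideanSpace ℂ Q) :
    inner ℂ (((adjoint V).comp V ^ i) x) y = inner ℂ x (((adjoint V).comp V ^ i) y) := by
  induction i generalizing x y with
  | zero => rfl
  | succ i ih =>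
    conv_rhs => rw [pow_succ', mul_apply_eq_comp, comp_apply, adjoint_inner_right]
    rw [pow_succ, mul_apply_eq_comp, ih, comp_apply, adjoint_inner_left]

theorem inner_gram_pow_even (V : EuclideanSpace ℂ Q →L[ℂ] EuclideanSpace ℂ F) (i : ℕ)
    (x : EuclideanSpace ℂ Q) :
    (inner ℂ x (((adjoint V).comp V ^ (2 * i)) x)).re = ‖((adjoint V).comp V ^ i) x‖ ^ 2 := by
  rw [two_mul, pow_add, mul_apply_eq_comp, ← inner_gram_pow]
  exact inner_self_eq_norm_sq (𝕜 := ℂ) _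

theorem inner_gram_pow_odd (V : EuclideanSpace ℂ Q →L[ℂ] EuclideanSpace ℂ F) (i : ℕ)
    (x : EuclideanSpace ℂ Q) :
    (inner ℂ x (((adjoint V).comp V ^ (2 * i + 1)) x)).re =
      ‖V (((adjoint V).comp V ^ i) x)‖ ^ 2 := by
  rw [show 2 * i + 1 = i + (1 + i) by ring, pow_add, mul_apply_eq_comp,
    ← inner_gram_pow, pow_add, pow_one, mul_apply_eq_comp, comp_apply,
    adjoint_inner_right]
  exact inner_self_eq_norm_sq (𝕜 := ℂ) _

theorem inner_gram_pow_nonneg (V : EuclideanSpace ℂ Q →L[ℂ] EuclideanSpace ℂ F) (j : ℕ)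
    (x : EuclideanSpace ℂ Q) : 0 ≤ (inner ℂ x (((adjoint V).comp V ^ j) x)).re := by
  rcases Nat.even_or_odd' j with ⟨i, rfl | rfl⟩
  · rw [inner_gram_pow_even]
    positivity
  · rw [inner_gram_pow_odd]
    positivity

/-- The moments of the operators `V† V` in the states `φ`, averaged over the index. -/
noncomputable def moment (V : I → EuclideanSpace ℂ Q →L[ℂ] EuclideanSpace ℂ F)
    (φ : I → EuclideanSpace ℂ Q) (j : ℕ) : ℝ :=
  (∑ H, (inner ℂ (φ H) (((adjoint (V H)).comp (V H) ^ j) (φ H))).re) / Fintype.card I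

variable (V : I → EuclideanSpace ℂ Q →L[ℂ] EuclideanSpace ℂ F) (φ : I → EuclideanSpace ℂ Q)

theorem moment_even (i : ℕ) : moment V φ (2 * i) =
    (∑ H, ‖((adjoint (V H)).comp (V H) ^ i) (φ H)‖ ^ 2) / Fintype.card I := by
  simp only [moment, inner_gram_pow_even]

theorem moment_odd (i : ℕ) : moment V φ (2 * i + 1) =
    (∑ H, ‖V H (((adjoint (V H)).comp (V H) ^ i) (φ H))‖ ^ 2) / Fintype.card I := by
  simp only [moment, inner_gram_pow_odd]

theorem moment_nonneg (j : ℕ) : 0 ≤ moment V φ j :=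
  div_nonneg (Finset.sum_nonneg fun H _ => inner_gram_pow_nonneg (V H) j (φ H)) (by positivity)

theorem moment_zero [Nonempty I] (hφ : ∀ H, ‖φ H‖ = 1) : moment V φ 0 = 1 := by
  have h := moment_even V φ 0
  simpa [hφ] using h

theorem moment_one : moment V φ 1 = (∑ H, ‖V H (φ H)‖ ^ 2) / Fintype.card I := by
  simpa using moment_odd V φ 0

/-- Cauchy-Schwarz for the averaged positive form given by `M^j`: the average of `⟨sφ + Mφ, M^j (sφ
+ Mφ)⟩` is a quadratic in `s` that is never negative, so its discriminant is at most zero. -/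
theorem moment_logConvex (j : ℕ) :
    moment V φ (j + 1) ^ 2 ≤ moment V φ j * moment V φ (j + 2) := by
  have key : ∀ s : ℝ, 0 ≤ moment V φ j * (s * s) + (2 * moment V φ (j + 1)) * s +
      moment V φ (j + 2) := by
    intro s
    have h : ∀ H, (inner ℂ (φ H) (((adjoint (V H)).comp (V H) ^ j) (φ H))).re * (s * s) +
        (2 * (inner ℂ (φ H) (((adjoint (V H)).comp (V H) ^ (j + 1)) (φ H))).re) * s +
        (inner ℂ (φ H) (((adjoint (V H)).comp (V H) ^ (j + 2)) (φ H))).re =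
        (inner ℂ ((s : ℂ) • φ H + ((adjoint (V H)).comp (V H) ^ 1) (φ H))
          (((adjoint (V H)).comp (V H) ^ j)
            ((s : ℂ) • φ H + ((adjoint (V H)).comp (V H) ^ 1) (φ H)))).re := by
      intro H
      rw [map_add, map_smul, inner_add_left, inner_add_right, inner_add_right, inner_gram_pow,
        inner_gram_pow]
      simp only [map_smul, ← mul_apply_eq_comp, ← pow_add]
      rw [show 1 + j = j + 1 by ring, show 1 + (j + 1) = j + 2 by ring]
      simp only [inner_smul_left, inner_smul_right, Complex.conj_ofReal, Complex.add_re,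
        Complex.re_ofReal_mul]
      ring
    have h2 : moment V φ j * (s * s) + (2 * moment V φ (j + 1)) * s + moment V φ (j + 2) =
        (∑ H, ((inner ℂ (φ H) (((adjoint (V H)).comp (V H) ^ j) (φ H))).re * (s * s) +
        (2 * (inner ℂ (φ H) (((adjoint (V H)).comp (V H) ^ (j + 1)) (φ H))).re) * s +
        (inner ℂ (φ H) (((adjoint (V H)).comp (V H) ^ (j + 2)) (φ H))).re)) /
          Fintype.card I := by
      simp only [moment, Finset.sum_add_distrib, ← Finset.sum_mul, ← Finset.mul_sum]
      ring
    rw [h2]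
    refine div_nonneg (Finset.sum_nonneg fun H _ => ?_) (by positivity)
    rw [h]
    exact inner_gram_pow_nonneg _ _ _
  have := discrim_le_zero key
  rw [discrim] at this
  nlinarith

end Moments

/-- The operator norm is at most the Hilbert-Schmidt norm. The right side does not involve `σ`,
which is how advice depending on the oracle is traded for fixed basis states. -/
theorem norm_sq_le_sum_ket {Q F : Type} [Fintype Q] [Fintype F]
    (L : EuclideanSpace ℂ Q →L[ℂ] EuclideanSpace ℂ F) (σ : EuclideanSpace ℂ Q) (hσ : ‖σ‖ = 1) :
    ‖L σ‖ ^ 2 ≤ ∑ q, ‖L (ket q)‖ ^ 2 := by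
  classical
  have h1 : σ = ∑ q, σ q • ket q := by
    ext q
    simp [ket_eq_single, Pi.single_apply]
  have h2 : ‖L σ‖ ≤ ∑ q, ‖σ q‖ * ‖L (ket q)‖ := by
    conv_lhs => rw [h1, map_sum]
    refine (norm_sum_le _ _).trans_eq ?_
    simp only [map_smul, norm_smul]
  calc ‖L σ‖ ^ 2 ≤ (∑ q, ‖σ q‖ * ‖L (ket q)‖) ^ 2 := by gcongr
    _ ≤ (∑ q, ‖σ q‖ ^ 2) * ∑ q, ‖L (ket q)‖ ^ 2 := Finset.sum_mul_sq_le_sq_mul_sq _ _ _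
    _ = ∑ q, ‖L (ket q)‖ ^ 2 := by rw [← EuclideanSpace.norm_sq_eq, hσ, one_pow, one_mul]

/-! ### From preparable states to bit-fixing algorithms -/

section BitFixing

variable {X Y R Ch Ans Q W Z : Type} [Fintype X] [AddCommGroup Y] [Fintype Y] [Fintype R]
  [Fintype Q] [Fintype W] [Fintype Z]

theorem Game.winWeight_zero (G : Game X Y R Ch Ans) (H : X → Y)
    (circuit : Ch → QueryCircuit X Y W) (out : X × Y × W → Ans) :
    G.winWeight H circuit out 0 = 0 := by
  simp [Game.winWeight]

theorem Game.winWeight_push (G : Game X Y R Ch Ans) (H : X → Y) (j : W ↪ Z)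
    {circuit : Ch → QueryCircuit X Y W} {circuit' : Ch → QueryCircuit X Y Z}
    (hrun : ∀ ch H ψ, (circuit' ch).run H (push (workEmb X Y j) ψ) =
      push (workEmb X Y j) ((circuit ch).run H ψ))
    {out : X × Y × W → Ans} {out' : X × Y × Z → Ans}
    (hout : ∀ b, out' (workEmb X Y j b) = out b) (ψ : EuclideanSpace ℂ (X × Y × W)) :
    G.winWeight H circuit' out' (push (workEmb X Y j) ψ) = G.winWeight H circuit out ψ := by
  unfold Game.winWeight
  congr 1
  refine Finset.sum_congr rfl fun r _ => ?_
  rw [hrun]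
  have := sum_norm_sq_push (workEmb X Y j) ((circuit ((G.samp r).eval H)).run H ψ)
    (fun b => (G.verify r (out' b)).eval H = true)
  simp only [hout] at this
  exact this

theorem Game.winWeight_le (G : Game X Y R Ch Ans) [Nonempty R] (H : X → Y)
    (circuit : Ch → QueryCircuit X Y W) (out : X × Y × W → Ans)
    (ψ : EuclideanSpace ℂ (X × Y × W)) : G.winWeight H circuit out ψ ≤ ‖ψ‖ ^ 2 := by
  rw [Game.winWeight, div_le_iff₀ (by positivity)]
  calc _ ≤ ∑ _r : R, ‖ψ‖ ^ 2 := by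
        refine Finset.sum_le_sum fun r _ => ?_
        rw [← ((circuit ((G.samp r).eval H)).run H).norm_map ψ, EuclideanSpace.norm_sq_eq]
        refine Finset.sum_le_sum fun b _ => ?_
        split_ifs
        · exact le_rfl
        · positivity
    _ = ‖ψ‖ ^ 2 * Fintype.card R := by simp [mul_comm]

open Classical in
theorem BitFixingAlg.leftover_apply (A : BitFixingAlg X Y Ch Ans) (H : X → Y) (b : X × Y × A.W) :
    A.leftover H b = if A.bit b = 0 then A.f.run H (ket (A.x₀, A.y₀, A.w₀)) b else 0 := by
  rw [ket_eq_single]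
  rfl

open Classical in
/-- Security in the bit-fixing model bounds the winning weight of an online algorithm started on
any family of states prepared with few queries. -/
theorem Game.BitFixingSecure.sum_winWeight_le {G : Game X Y R Ch Ans} {P ν : ℝ} {T : ℕ}
    (hG : G.BitFixingSecure P T ν) {circuit : Ch → QueryCircuit X Y Z}
    (hT : ∀ ch, (circuit ch).numQueries ≤ T) (out : X × Y × Z → Ans) (z₀ : Z)
    (κ : EuclideanSpace ℂ Q →ₗᵢ[ℂ] EuclideanSpace ℂ (X × Y × Z)) {q : ℕ} (hq : (q : ℝ) ≤ P)
    {φ : (X → Y) → EuclideanSpace ℂ Q} (hφ : Preparable q φ) :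
    ∑ H, G.winWeight H circuit out (κ (φ H)) ≤ ν * ∑ H, ‖φ H‖ ^ 2 := by
  obtain ⟨W, _, b₀, C, rest, hCq, hC⟩ := hφ.exists_circuit κ
  choose B hBq hB using fun ch =>
    (circuit ch).exists_lift (Function.Embedding.inr (α := W) (β := Z))
  let A : BitFixingAlg X Y Ch Ans :=
    { W := W ⊕ Z
      x₀ := b₀.1
      y₀ := b₀.2.1
      w₀ := b₀.2.2
      f := C
      -- The bit is `0` exactly on the summand that holds `κ (φ H)`, so conditioning on it performs
      -- the postselection. The answer `out` on the other summand is a dummy, which is why some `z₀`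
      -- is needed.
      bit := fun b => b.2.2.elim (fun _ => 1) fun _ => 0
      B := B
      out := fun b => out (b.1, b.2.1, b.2.2.elim (fun _ => z₀) id) }
  have hleft : ∀ H, A.leftover H = push (workEmb X Y Function.Embedding.inr) (κ (φ H)) := by
    intro H
    have hrun : A.f.run H (ket (A.x₀, A.y₀, A.w₀)) = _ := hC H
    ext ⟨x, y, w | z⟩
    · rw [push_apply_of_forall_ne, BitFixingAlg.leftover_apply]
      · exact if_neg one_ne_zero
      · rintro ⟨x', y', z⟩ h
        simp at h
    · have h0 : push (workEmb X Y (Function.Embedding.inl (β := Z))) (rest H)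
          (x, y, Sum.inr z) = 0 := by
        refine push_apply_of_forall_ne _ _ ?_
        rintro ⟨x', y', w⟩ h
        simp at h
      rw [BitFixingAlg.leftover_apply, hrun, PiLp.add_apply, h0, add_zero]
      exact if_pos rfl
  have hN : (0 : ℝ) < Fintype.card (X → Y) := by positivity
  have haccept : A.acceptProb = (∑ H, ‖φ H‖ ^ 2) / Fintype.card (X → Y) := by
    simp only [BitFixingAlg.acceptProb, hleft, LinearIsometry.norm_map]
  have hjoint : A.jointProb G =
      (∑ H, G.winWeight H circuit out (κ (φ H))) / Fintype.card (X → Y) := by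
    rw [BitFixingAlg.jointProb]
    congr 1
    refine Finset.sum_congr rfl fun H _ => ?_
    rw [hleft]
    exact G.winWeight_push H Function.Embedding.inr hB (fun b => rfl) (κ (φ H))
  have hnonneg : 0 ≤ ∑ H, ‖φ H‖ ^ 2 := by positivity
  -- If the first stage never accepts, the security hypothesis says nothing, but then all states
  -- vanish and both sides are `0`.
  rcases hnonneg.eq_or_lt with h | h
  · have hzero : ∀ H, φ H = 0 := by
      intro H
      have := (Finset.sum_eq_zero_iff_of_nonneg fun H _ => by positivity).1 h.symm H
        (Finset.mem_univ H)
      simpa using this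
    simp [hzero, Game.winWeight_zero]
  · have hpos : 0 < A.acceptProb := by
      rw [haccept]
      positivity
    have hwin := hG A ((Nat.cast_le.2 hCq).trans hq) (fun ch => (hBq ch).trans_le (hT ch)) hpos
    rw [BitFixingAlg.winProb, div_le_iff₀ hpos, hjoint, haccept, ← mul_div_assoc,
      div_le_div_iff_of_pos_right hN] at hwin
    exact hwin

end BitFixing

/-! ### The power inequality for the winning probability -/

section Core

open ContinuousLinearMap

variable {X Y R Ch Ans Q F : Type} [Fintype X] [AddCommGroup Y] [Fintype Y] [Fintype R]
  [Fintype Q] [Fintype F]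

/-- Each factor of the Gram operator is one application of `V H` and one of its adjoint, at `t`
queries each. -/
theorem Preparable.gram_pow {t q : ℕ} {V : (X → Y) → EuclideanSpace ℂ Q →L[ℂ] EuclideanSpace ℂ F}
    (hV : Simulable t V) {φ : (X → Y) → EuclideanSpace ℂ Q} (hφ : Preparable q φ) (i : ℕ) :
    Preparable (q + 2 * i * t) fun H => ((adjoint (V H)).comp (V H) ^ i) (φ H) := by
  induction i with
  | zero => simpa using hφ
  | succ i ih =>
    have h := hV.2 _ _ (hV.1 _ _ ih)
    rw [show q + 2 * (i + 1) * t = q + 2 * i * t + t + t by ring]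
    simp only [pow_succ', mul_apply_eq_comp, comp_apply]
    exact h

namespace NonUniformAlg

variable {S : ℕ}

/-- The labels of the initial basis states. -/
def initEmb (A : NonUniformAlg X Y Ch Ans S) :
    (Fin S → Bool) ↪ X × Y × (Fin S → Bool) × A.W where
  toFun q := (A.x₀, A.y₀, q, A.w₀)
  inj' q q' h := by simpa using h

theorem initEmb_apply (A : NonUniformAlg X Y Ch Ans S) (q : Fin S → Bool) :
    A.initEmb q = (A.x₀, A.y₀, q, A.w₀) := rfl

theorem initState_eq_push (A : NonUniformAlg X Y Ch Ans S) (H : X → Y) :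
    A.initState H = push A.initEmb (A.advice H) := by
  ext ⟨x, y, q, w⟩
  by_cases h : x = A.x₀ ∧ y = A.y₀ ∧ w = A.w₀
  · obtain ⟨rfl, rfl, rfl⟩ := h
    rw [push_apply_of_eq A.initEmb _ (A.initEmb_apply q)]
    simp [initState]
  · rw [push_apply_of_forall_ne]
    · simp only [initState]
      exact if_neg h
    · intro q' hq'
      simp only [initEmb_apply, Prod.mk.injEq] at hq'
      exact h ⟨hq'.1.symm, hq'.2.1.symm, hq'.2.2.2.symm⟩

theorem norm_initState (A : NonUniformAlg X Y Ch Ans S) (H : X → Y) : ‖A.initState H‖ = 1 := by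
  rw [initState_eq_push, LinearIsometry.norm_map, A.advice_norm]

theorem winProb_le_one [Nonempty R] (A : NonUniformAlg X Y Ch Ans S) (G : Game X Y R Ch Ans) :
    A.winProb G ≤ 1 := by
  classical
  rw [winProb, div_le_one (by positivity)]
  calc _ ≤ ∑ _H : X → Y, (1 : ℝ) := by
        refine Finset.sum_le_sum fun H _ => (G.winWeight_le _ _ _ _).trans ?_
        rw [norm_initState, one_pow]
    _ = _ := by simp

/-- The odd exponent comes from reading the moment of order `2i+1` as a play of the game on `M^i φ`,
and the moment of order `2i` as the acceptance probability of the stage preparing that state. -/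
theorem winProb_pow_le [Nonempty X] [Nonempty R] (A : NonUniformAlg X Y Ch Ans S)
    {G : Game X Y R Ch Ans} {T : ℕ} (hT : ∀ ch, (A.circuit ch).numQueries ≤ T) {P ν : ℝ}
    (hG : G.BitFixingSecure P T ν) {i : ℕ}
    (hi : (2 * i : ℝ) * (T + G.tVerify + G.tSamp) ≤ P) :
    0 ≤ ν ∧ A.winProb G ^ (2 * i + 1) ≤ 2 ^ S * ν ^ (2 * i + 1) := by
  classical
  obtain ⟨F, _, V, hsim, hV⟩ := G.exists_winOperator T A.circuit hT A.out (push A.initEmb)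
  have hN : (0 : ℝ) < Fintype.card (X → Y) := by positivity
  have hstep : ∀ q, ∀ k ≤ i, moment V (fun _ => ket q) (2 * k + 1) ≤
      ν * moment V (fun _ => ket q) (2 * k) := by
    intro q k hk
    have hprep := Preparable.gram_pow hsim (preparable_single (X := X) (Y := Y) q) k
    have hcost : ((0 + 2 * k * (G.tSamp + T + G.tVerify) : ℕ) : ℝ) ≤ P := by
      refine le_trans ?_ hi
      push_cast
      have : (k : ℝ) ≤ i := by exact_mod_cast hk
      have h2 : (0 : ℝ) ≤ T + G.tVerify + G.tSamp := by positivity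
      nlinarith [mul_le_mul_of_nonneg_right this h2]
    have h := hG.sum_winWeight_le hT A.out (q, A.w₀) (push A.initEmb) hcost hprep
    rw [moment_odd, moment_even, ← mul_div_assoc, div_le_div_iff_of_pos_right hN]
    simp only [hV]
    exact h
  have hzero : ∀ q, moment V (fun _ => ket q) 0 = 1 := fun q => moment_zero V _ fun _ => norm_ket q
  have hν : 0 ≤ ν := by
    -- The case of an arbitrary basis state and no preparation queries: `0 ≤ m_1 ≤ ν m_0 = ν`.
    have h := hstep (fun _ => true) 0 (Nat.zero_le _)
    rw [mul_zero, hzero, mul_one] at h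
    exact (moment_nonneg _ _ _).trans h
  have hwin : A.winProb G = moment V A.advice 1 := by
    simp only [moment_one, hV, winProb, initState_eq_push]
  refine ⟨hν, ?_⟩
  calc A.winProb G ^ (2 * i + 1) = moment V A.advice 1 ^ (2 * i + 1) := by rw [hwin]
    _ ≤ moment V A.advice (2 * i + 1) := pow_le_of_logConvex (moment_nonneg _ _)
        (moment_logConvex _ _) (moment_zero _ _ A.advice_norm) _
    _ ≤ ∑ q, moment V (fun _ => ket q) (2 * i + 1) := by
        simp only [moment_odd]
        rw [← Finset.sum_div, div_le_div_iff_of_pos_right hN, Finset.sum_comm]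
        exact Finset.sum_le_sum fun H _ =>
          norm_sq_le_sum_ket ((V H).comp ((adjoint (V H)).comp (V H) ^ i)) _ (A.advice_norm H)
    _ ≤ ∑ _q : Fin S → Bool, ν ^ (2 * i + 1) := Finset.sum_le_sum fun q _ =>
        le_pow_of_logConvex (moment_nonneg _ _) (moment_logConvex _ _) (hzero q) hν _
          (hstep q i le_rfl)
    _ = 2 ^ S * ν ^ (2 * i + 1) := by simp

end NonUniformAlg

end Core

/-! ### The numerical estimate for the additive bound -/

section Arithmetic

/-- By `1 - γ ≤ exp (-γ)` it suffices that `S log 2 ≤ (2i+1) γ`. As `S < (2i+2) γ`, this follows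
from `log 2 < 3/4 ≤ (2i+1)/(2i+2)` once `i ≥ 1`. For `i = 0` the last ratio is only `1/2`, but then
`S = 1` and `γ > 1/2`. -/
theorem two_pow_mul_pow_le_one {S i : ℕ} {γ : ℝ} (hγ1 : γ < 1) (hS : 1 ≤ S)
    (hi : (S : ℝ) < (2 * i + 2) * γ) : 2 ^ S * (1 - γ) ^ (2 * i + 1) ≤ 1 := by
  rcases Nat.eq_zero_or_pos i with rfl | hpos
  · have h1 : (S : ℝ) < 2 := by
      push_cast at hi
      linarith
    have h2 : S = 1 := by
      have : S < 2 := by exact_mod_cast h1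
      lia
    subst h2
    push_cast at hi
    simp only [mul_zero, zero_add, pow_one]
    linarith
  · have hi1 : (1 : ℝ) ≤ i := by exact_mod_cast hpos
    have hexp : (1 - γ) ^ (2 * i + 1) ≤ Real.exp (-γ) ^ (2 * i + 1) :=
      pow_le_pow_left₀ (by linarith) (by linarith [Real.add_one_le_exp (-γ)]) _
    have h2 : (2 : ℝ) ^ S = Real.exp (S * Real.log 2) := by
      rw [mul_comm, Real.exp_mul, Real.exp_log two_pos, Real.rpow_natCast]
    calc 2 ^ S * (1 - γ) ^ (2 * i + 1) ≤ 2 ^ S * Real.exp (-γ) ^ (2 * i + 1) := by gcongr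
      _ = Real.exp (S * Real.log 2 + (2 * i + 1 : ℕ) * -γ) := by
          rw [h2, Real.exp_add, Real.exp_nat_mul (-γ)]
      _ ≤ 1 := by
          rw [Real.exp_le_one_iff]
          push_cast
          have hlog : Real.log 2 < 3 / 4 := by linarith [Real.log_two_lt_d9]
          have hSpos : (0 : ℝ) < S := by exact_mod_cast hS
          have hγ : 0 < γ := by
            by_contra h
            push Not at h
            nlinarith
          nlinarith

end Arithmetic

end QROM

theorem theorem5p1 {X Y R Ch Ans : Type} [Fintype X] [Nonempty X] [Fintype Y] [AddCommGroup Y]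
    [Fintype R] [Nonempty R] (G : QROM.Game X Y R Ch Ans) (S T : ℕ) (P : ℝ)
    (hP : P = (S : ℝ) * ((T : ℝ) + (G.tVerify : ℝ) + (G.tSamp : ℝ))) (ν : ℝ → ℕ → ℝ) :
    (G.BitFixingSecure P T (ν P T) → G.NonUniformSecure S T (2 * ν P T)) ∧
    ((∀ γ : ℝ, 0 < γ → G.BitFixingSecure (P / γ) T (ν (P / γ) T)) →
      G.NonUniformSecure S T (⨅ γ : Set.Ioi (0 : ℝ), (ν (P / (γ : ℝ)) T + (γ : ℝ)))) := by
  have ht : (0 : ℝ) ≤ T + G.tVerify + G.tSamp := by positivity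
  refine ⟨fun hG A hT => ?_, fun hG A hT => ?_⟩
  · have hi : (2 * (S / 2 : ℕ) : ℝ) * (T + G.tVerify + G.tSamp) ≤ P := by
      rw [hP]
      refine mul_le_mul_of_nonneg_right ?_ ht
      exact_mod_cast Nat.mul_div_le S 2
    obtain ⟨hν, h⟩ := A.winProb_pow_le hT hG hi
    refine le_of_pow_le_pow_left₀ (n := 2 * (S / 2) + 1) (by lia) (by positivity) (h.trans ?_)
    rw [mul_pow]
    refine mul_le_mul_of_nonneg_right ?_ (by positivity)
    exact pow_le_pow_right₀ one_le_two (by lia)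
  · have : Nonempty (Set.Ioi (0 : ℝ)) := ⟨⟨1, Set.mem_Ioi.2 one_pos⟩⟩
    refine le_ciInf fun ⟨γ, (hγ : 0 < γ)⟩ => ?_
    change A.winProb G ≤ ν (P / γ) T + γ
    -- The largest `i` with `2i ≤ S/γ`; maximality gives `S < (2i+2) γ`.
    let i : ℕ := ⌊(S : ℝ) / (2 * γ)⌋₊
    have hi₁ : (i : ℝ) ≤ S / (2 * γ) := Nat.floor_le (by positivity)
    have hi₂ : (S : ℝ) / (2 * γ) < i + 1 := Nat.lt_floor_add_one _
    rw [le_div_iff₀ (by positivity)] at hi₁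
    rw [div_lt_iff₀ (by positivity)] at hi₂
    have hi : (2 * i : ℝ) * (T + G.tVerify + G.tSamp) ≤ P / γ := by
      rw [hP, le_div_iff₀ hγ]
      nlinarith [mul_le_mul_of_nonneg_right hi₁ ht]
    obtain ⟨hν, h⟩ := A.winProb_pow_le hT (hG γ hγ) hi
    have hle := A.winProb_le_one G
    by_contra! hlt
    have hw : 0 < A.winProb G := by linarith
    have hγ1 : γ < 1 := by linarith
    -- Since `winProb ≤ 1`, the additive gap `γ` is at least the multiplicative gap `γ * winProb`.
    -- The factor `(1 - γ) ^ (2i+1)` then absorbs `2^S`, which contradicts the power inequality.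
    have hratio : ν (P / γ) T < (1 - γ) * A.winProb G := by nlinarith
    rcases Nat.eq_zero_or_pos S with rfl | hS
    · rw [pow_zero, one_mul] at h
      have := le_of_pow_le_pow_left₀ (by lia) hν h
      linarith
    · have h1 : 2 ^ S * ν (P / γ) T ^ (2 * i + 1) <
          2 ^ S * ((1 - γ) * A.winProb G) ^ (2 * i + 1) := by
        gcongr
      rw [mul_pow, ← mul_assoc] at h1
      have h2 := QROM.two_pow_mul_pow_le_one (S := S) (i := i) hγ1 hS (by linarith)
      have h3 : 0 < A.winProb G ^ (2 * i + 1) := by positivity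
      nlinarith
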